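/- Let $n\ge 1$, let $A,F,Q\in\mathbb R^{n\times n}$ with $F,Q$ symmetric positive definite, and let $F=LL^\top$ be the Cholesky factorization of $F$ ($L$ lower triangular with positive diagonal). Write $\mathcal R(X):=A^\top X+XA-XFX+Q$, let $\mathcal W(M):=\{x^HMx:\ x\in\mathbb C^n,\ \|x\|_2=1\}$ be the numerical range, let $\mathbb C^-:=\{z:\Re z<0\}$, and call a real matrix *stable* if all its eigenvalues lie in $\mathbb C^-$. Denote by $\lambda_{\min},\lambda_{\max}$ the extreme eigenvalues of a symmetric matrix and by $\kappa(F)=\|F\|_2\|F^{-1}\|_2$ the condition number, and let $\mathrm{vec}$ be the column-stacking map. Consider the inexact Newton–Kleinman (TINK) iteration without truncation, started at $\widetilde X_0$. In outer iteration $k$ put $$\widetilde A_{cl,k}:=A-F\widetilde X_k,\qquad \widetilde{\mathcal A}_k:=I\otimes \widetilde A_{cl,k}^\top+\widetilde A_{cl,k}^\top\otimes I,\qquad b_k:=-\mathrm{vec}(\widetilde X_kF\widetilde X_k+Q).$$ Let $\mathrm{vec}(\widehat X_{k+1})$ be the result of $\overline{it}_k$ iterations of GMRES with zero initial guess for $\widetilde{\mathcal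 A}_kx=b_k$, i.e. the minimizer of $\|b_k-\widetilde{\mathcal A}_kx\|_2$ over the Krylov space $\mathrm{span}\{b_k,\widetilde{\mathcal A}_kb_k,\dots,\widetilde{\mathcal A}_k^{\,\overline{it}_k-1}b_k\}$. Then set $$\widetilde X_{k+1}:=(1-\lambda_k)\widetilde X_k+\lambda_k\widehat X_{k+1}.$$ Without line search, $\lambda_k=1$ for all $k$. With line search (parameter $\alpha>0$), $\lambda_k$ is any number in $(0,1)$ found such that $$\|\mathcal R((1-\lambda_k)\widetilde X_k+\lambda_k\widehat X_{k+1})\|_2\le(1-\lambda_k\alpha)\|\mathcal R(\widetilde X_k)\|_2 .$$ **Theorem.** Let $\mathcal W(L^{-1}AL)\subset\mathbb C^-$ and let $\widetilde X_0$ be symmetric positive semidefinite with $\widetilde A_{cl,0}=A-F\widetilde X_0$ stable. Put $$\widetilde{\mathcal L}_k:=(L^\top\otimes L^\top)\,\widetilde{\mathcal A}_k\,(L^{-\top}\otimes L^{-\top})=I\otimes L^\top\widetilde A_{cl,k}^\top L^{-\top}+L^\top\widetilde A_{cl,k}^\top L^{-\top}\otimes I .$$ Suppose that in each outer iteration performed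 the number of GMRES iterations satisfies $$\overline{it}_k\ \ge\ \frac{2\log\left((1+\sqrt2)\,\dfrac{\kappa(F)\,\|\widetilde X_kF\widetilde X_k+Q\|_F}{\lambda_{\min}(Q)}\right)}{-\log\left(1-\dfrac{\lambda_{\min}^2\big(-(\widetilde{\mathcal L}_k+\widetilde{\mathcal L}_k^\top)/2\big)}{\lambda_{\max}(\widetilde{\mathcal L}_k\widetilde{\mathcal L}_k^\top)}\right)} ,$$ where the right-hand side is read as $0$ if the argument of the logarithm in the denominator is $0$. Then, for any number of outer iterations performed, every iterate $\widetilde X_k$, $k\ge0$ (including the last one), is symmetric and positive semidefinite, and $\widetilde A_{cl,k}=A-F\widetilde X_k$ is stable. Moreover the iteration is well defined: at every iterate $\widetilde{\mathcal A}_k$ is nonsingular and, for every number of inner iterations, the GMRES result $\widehat X_{k+1}$ exists and is unique. -/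

import Mathlib

open scoped Matrix Kronecker

noncomputable section

namespace Tink

variable {n : ℕ} {ι : Type*} [Fintype ι] [DecidableEq ι]

/-- The numerical range `{xᴴ M x : x ∈ ℂⁿ, ‖x‖₂ = 1}` of a complex matrix. -/
def numericalRange (M : Matrix ι ι ℂ) : Set ℂ :=
  {z | ∃ x : EuclideanSpace ℂ ι, ‖x‖ = 1 ∧ z = star (x : ι → ℂ) ⬝ᵥ (M *ᵥ (x : ι → ℂ))}

/-- A real matrix is stable if all its complex eigenvalues lie in the open left half-plane. -/
def IsStable (M : Matrix ι ι ℝ) : Prop :=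
  ∀ μ ∈ spectrum ℂ (M.map (algebraMap ℝ ℂ)), μ.re < 0

/-- The spectral norm `‖M‖₂`. -/
def specNorm (M : Matrix ι ι ℝ) : ℝ :=
  ‖Matrix.toEuclideanCLM (n := ι) (𝕜 := ℝ) M‖

/-- The Frobenius norm `‖M‖_F`. -/
def frobNorm (M : Matrix ι ι ℝ) : ℝ :=
  Real.sqrt (∑ i, ∑ j, M i j ^ 2)

/-- The 2-norm condition number (of an invertible matrix). -/
def cond2 (M : Matrix ι ι ℝ) : ℝ :=
  specNorm M * specNorm M⁻¹

/-- The smallest eigenvalue (of a symmetric matrix). -/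
def lambdaMin (M : Matrix ι ι ℝ) : ℝ :=
  sInf (spectrum ℝ M)

/-- The largest eigenvalue (of a symmetric matrix). -/
def lambdaMax (M : Matrix ι ι ℝ) : ℝ :=
  sSup (spectrum ℝ M)

/-- `L` is the Cholesky factor of `F`: lower triangular with positive diagonal and `F = L Lᵀ`. -/
structure IsCholeskyFactor (L F : Matrix (Fin n) (Fin n) ℝ) : Prop where
  lower : ∀ i j, i < j → L i j = 0
  diag_pos : ∀ i, 0 < L i i
  mul_transpose : L * Lᵀ = F

/-- The Riccati residual `ℛ(X) = Aᵀ X + X A - X F X + Q`. -/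
def riccati (A F Q X : Matrix ι ι ℝ) : Matrix ι ι ℝ :=
  Aᵀ * X + X * A - X * F * X + Q

/-- The closed-loop matrix `A - F X`. -/
def closedLoop (A F X : Matrix ι ι ℝ) : Matrix ι ι ℝ :=
  A - F * X

/-- The `n² × n²` matrix `I ⊗ Cᵀ + Cᵀ ⊗ I` of the Lyapunov operator `X ↦ Cᵀ X + X C`, with respect
to the column-stacking map `Matrix.vec`. -/
def lyapMatrix (C : Matrix ι ι ℝ) : Matrix (ι × ι) (ι × ι) ℝ :=
  (1 : Matrix ι ι ℝ) ⊗ₖ Cᵀ + Cᵀ ⊗ₖ (1 : Matrix ι ι ℝ)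

/-- The matrix `(Lᵀ ⊗ Lᵀ) (I ⊗ Cᵀ + Cᵀ ⊗ I) (L⁻ᵀ ⊗ L⁻ᵀ)`. -/
def scaledLyapMatrix (L C : Matrix ι ι ℝ) : Matrix (ι × ι) (ι × ι) ℝ :=
  (Lᵀ ⊗ₖ Lᵀ) * lyapMatrix C * ((L⁻¹)ᵀ ⊗ₖ (L⁻¹)ᵀ)

/-- The Krylov subspace `span {b, M b, …, M^(m-1) b}`. -/
def krylov (M : Matrix ι ι ℝ) (b : ι → ℝ) (m : ℕ) : Submodule ℝ (ι → ℝ) :=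
  Submodule.span ℝ ((fun j : ℕ => (M ^ j) *ᵥ b) '' {j | j < m})

/-- `x` is the result of `m` iterations of GMRES for `M x = b` with zero initial guess: it minimizes
the Euclidean norm of the residual over the `m`-th Krylov subspace. -/
structure IsGMRESIterate (M : Matrix ι ι ℝ) (b : ι → ℝ) (m : ℕ) (x : ι → ℝ) : Prop where
  mem : x ∈ krylov M b m
  min : ∀ y ∈ krylov M b m,
    ‖(WithLp.toLp 2 (b - M *ᵥ x) : EuclideanSpace ℝ ι)‖ ≤
      ‖(WithLp.toLp 2 (b - M *ᵥ y) : EuclideanSpace ℝ ι)‖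

/-- `Xhat` is obtained by `m` iterations of GMRES on the vectorized Newton–Kleinman equation
`Cᵀ Y + Y C = -(X F X + Q)`, `C = A - F X`, at the current iterate `X`. -/
def IsInnerSolve (A F Q X : Matrix ι ι ℝ) (m : ℕ) (Xhat : Matrix ι ι ℝ) : Prop :=
  IsGMRESIterate (lyapMatrix (closedLoop A F X)) (-(X * F * X + Q).vec) m Xhat.vec

/-- The matrices `X 0, …, X N` are produced by `N` outer iterations of the TINK algorithm without
truncation, with start `X₀`, with `it k` GMRES iterations in the `k`-th outer iteration, inner
solutions `Xhat (k + 1)` and step lengths `lam k`. If the flag `lineSearch` is set, `lam k` is any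
number in `(0, 1)` satisfying the line search condition with parameter `α`; otherwise it is `1`.
The stopping test of the algorithm only determines the number `N` of outer iterations. -/
structure IsRun (A F Q X₀ : Matrix ι ι ℝ) (lineSearch : Bool) (α : ℝ) (N : ℕ) (it : ℕ → ℕ)
    (X Xhat : ℕ → Matrix ι ι ℝ) (lam : ℕ → ℝ) : Prop where
  start : X 0 = X₀
  inner : ∀ k < N, IsInnerSolve A F Q (X k) (it k) (Xhat (k + 1))
  step_search : lineSearch = true → ∀ k < N, 0 < lam k ∧ lam k < 1 ∧
    specNorm (riccati A F Q ((1 - lam k) • X k + lam k • Xhat (k + 1))) ≤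
      (1 - lam k * α) * specNorm (riccati A F Q (X k))
  step_full : lineSearch = false → ∀ k < N, lam k = 1
  update : ∀ k < N, X (k + 1) = (1 - lam k) • X k + lam k • Xhat (k + 1)

/-- The lower bound on the number of GMRES iterations at the iterate `X`. If the argument of the
logarithm in the denominator is `0`, the quotient is `0`, its limit value. -/
def iterBound (A F Q L X : Matrix ι ι ℝ) : ℝ :=
  let S := scaledLyapMatrix L (closedLoop A F X)
  2 * Real.log ((1 + Real.sqrt 2) * (cond2 F * frobNorm (X * F * X + Q) / lambdaMin Q)) /
    (-Real.log (1 - lambdaMin (-((1 / 2 : ℝ) • (S + Sᵀ))) ^ 2 / lambdaMax (S * Sᵀ)))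

end Tink

end

noncomputable section

namespace Tink

/-! ### Norm and extreme-eigenvalue inequalities -/

section Generic

variable {ι : Type*} [Fintype ι]

/-! The invariant is positive semidefiniteness of the iterate `X`. Since `F = L * Lᵀ`, conjugation
gives `L⁻¹ (A - F X) L = L⁻¹ A L - Lᵀ X L`, whose symmetric part is negative definite once `X` is
positive semidefinite (`negDefPart_conj_closedLoop`). Stability and nonsingularity of the Lyapunov
matrix follow at once.

To pass the invariant on, GMRES is compared with a Richardson iteration. The scaled Lyapunov matrix
has negative definite symmetric part, so Elman's factor contracts its residuals
(`NegDefPart.elman_pow`); scaling and unscaling cost the factor `cond2 F` (`frobNorm_residual_le`).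
The iteration bound then makes the residual `R` smaller in Frobenius norm than the least eigenvalue
of `Q`. The inner solution therefore solves exactly a Lyapunov equation with right-hand side `-(X F
X) - Q - R`, still negative definite, and so is positive semidefinite (`posSemidef_of_lyapunov`).
The update is a convex combination, which stays in the cone. -/

lemma norm_toLp_sq (v : ι → ℝ) : ‖(WithLp.toLp 2 v : EuclideanSpace ℝ ι)‖ ^ 2 = v ⬝ᵥ v := by
  rw [EuclideanSpace.real_norm_sq_eq]
  simp [dotProduct, sq]

lemma norm_toLp_le_iff (v w : ι → ℝ) :
    ‖(WithLp.toLp 2 v : EuclideanSpace ℝ ι)‖ ≤ ‖(WithLp.toLp 2 w : EuclideanSpace ℝ ι)‖ ↔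
      v ⬝ᵥ v ≤ w ⬝ᵥ w := by
  rw [← norm_toLp_sq, ← norm_toLp_sq, sq_le_sq₀ (norm_nonneg _) (norm_nonneg _)]

lemma dotProduct_self_nonneg' (v : ι → ℝ) : 0 ≤ v ⬝ᵥ v := by
  rw [← norm_toLp_sq]; positivity

lemma dotProduct_self_pos {v : ι → ℝ} (hv : v ≠ 0) : 0 < v ⬝ᵥ v :=
  lt_of_le_of_ne (dotProduct_self_nonneg' v) fun h => hv (dotProduct_self_eq_zero.1 h.symm)

lemma frobNorm_sq (M : Matrix ι ι ℝ) : frobNorm M ^ 2 = M.vec ⬝ᵥ M.vec := by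
  rw [frobNorm, Real.sq_sqrt (by positivity), Finset.sum_comm]
  simp [dotProduct, Fintype.sum_prod_type, sq]

lemma frobNorm_nonneg (M : Matrix ι ι ℝ) : 0 ≤ frobNorm M := Real.sqrt_nonneg _

lemma frobNorm_transpose (M : Matrix ι ι ℝ) : frobNorm Mᵀ = frobNorm M := by
  rw [frobNorm, frobNorm, Finset.sum_comm]; rfl

lemma dotProduct_mulVec_le_frobNorm (M : Matrix ι ι ℝ) (v : ι → ℝ) :
    v ⬝ᵥ (M *ᵥ v) ≤ frobNorm M * (v ⬝ᵥ v) := by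
  have h1 : (v ⬝ᵥ (M *ᵥ v)) ^ 2 ≤ (v ⬝ᵥ v) * ((M *ᵥ v) ⬝ᵥ (M *ᵥ v)) := by
    simpa [dotProduct, sq] using Finset.sum_mul_sq_le_sq_mul_sq Finset.univ v (M *ᵥ v)
  have h2 : (M *ᵥ v) ⬝ᵥ (M *ᵥ v) ≤ frobNorm M ^ 2 * (v ⬝ᵥ v) := by
    rw [frobNorm, Real.sq_sqrt (by positivity), Finset.sum_mul]
    refine Finset.sum_le_sum fun i _ => ?_
    simpa [dotProduct, sq, Matrix.mulVec] using
      Finset.sum_mul_sq_le_sq_mul_sq Finset.univ (M i) v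
  refine abs_le_of_sq_le_sq' ?_ (mul_nonneg (frobNorm_nonneg _) (dotProduct_self_nonneg' v)) |>.2
  nlinarith [mul_le_mul_of_nonneg_left h2 (dotProduct_self_nonneg' v)]

lemma dotProduct_transpose_mulVec (M : Matrix ι ι ℝ) (v w : ι → ℝ) :
    v ⬝ᵥ (Mᵀ *ᵥ w) = (M *ᵥ v) ⬝ᵥ w := by
  rw [Matrix.dotProduct_mulVec, Matrix.vecMul_transpose]

/-- `M` has negative definite symmetric part. -/
def NegDefPart (M : Matrix ι ι ℝ) : Prop := ∀ v : ι → ℝ, v ≠ 0 → v ⬝ᵥ (M *ᵥ v) < 0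

lemma NegDefPart.posDef {M : Matrix ι ι ℝ} (h : NegDefPart M) :
    (-((1 / 2 : ℝ) • (M + Mᵀ))).PosDef := by
  refine Matrix.PosDef.of_dotProduct_mulVec_pos ?_ ?_
  · rw [Matrix.IsHermitian, Matrix.conjTranspose_eq_transpose_of_trivial]
    simp [add_comm]
  · intro v hv
    have := h v hv
    simp only [Matrix.neg_mulVec, Matrix.smul_mulVec, Matrix.add_mulVec, dotProduct_neg, star_trivial,
      dotProduct_smul, dotProduct_add, dotProduct_transpose_mulVec, smul_eq_mul]
    rw [dotProduct_comm (M *ᵥ v) v]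
    linarith

variable [DecidableEq ι]

lemma specNorm_nonneg (M : Matrix ι ι ℝ) : 0 ≤ specNorm M := norm_nonneg _

lemma dotProduct_mulVec_self_le (M : Matrix ι ι ℝ) (v : ι → ℝ) :
    (M *ᵥ v) ⬝ᵥ (M *ᵥ v) ≤ specNorm M ^ 2 * (v ⬝ᵥ v) := by
  rw [← norm_toLp_sq, ← norm_toLp_sq, ← mul_pow, ← Matrix.toEuclideanCLM_toLp]
  exact pow_le_pow_left₀ (norm_nonneg _) (ContinuousLinearMap.le_opNorm _ _) 2

open scoped Matrix.Norms.L2Operator in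
lemma specNorm_transpose (M : Matrix ι ι ℝ) : specNorm Mᵀ = specNorm M := by
  rw [← Matrix.conjTranspose_eq_transpose_of_trivial]
  exact Matrix.l2_opNorm_conjTranspose M

open scoped Matrix.Norms.L2Operator in
lemma specNorm_mul_transpose (M : Matrix ι ι ℝ) : specNorm (M * Mᵀ) = specNorm M ^ 2 := by
  have h := Matrix.l2_opNorm_conjTranspose_mul_self Mᵀ
  rw [Matrix.conjTranspose_eq_transpose_of_trivial, Matrix.transpose_transpose] at h
  rw [← specNorm_transpose M, sq]
  exact h

lemma frobNorm_mul_le (M Y : Matrix ι ι ℝ) : frobNorm (M * Y) ≤ specNorm M * frobNorm Y := by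
  rw [← sq_le_sq₀ (frobNorm_nonneg _) (mul_nonneg (specNorm_nonneg _) (frobNorm_nonneg _)),
    mul_pow, frobNorm_sq, frobNorm_sq]
  simp only [dotProduct, Fintype.sum_prod_type, Finset.mul_sum (s := Finset.univ)]
  refine Finset.sum_le_sum fun j _ => ?_
  simpa [dotProduct, Finset.mul_sum, Matrix.mulVec, Matrix.mul_apply, Matrix.vec] using
    dotProduct_mulVec_self_le M (fun i => Y i j)

lemma frobNorm_mul_mul_transpose_le (M Y : Matrix ι ι ℝ) :
    frobNorm (M * Y * Mᵀ) ≤ specNorm M ^ 2 * frobNorm Y := by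
  have h : (M * Y * Mᵀ) = (M * (M * Y)ᵀ)ᵀ := by simp [Matrix.mul_assoc]
  rw [h, frobNorm_transpose]
  refine (frobNorm_mul_le _ _).trans ?_
  rw [frobNorm_transpose, sq, mul_assoc]
  exact mul_le_mul_of_nonneg_left (frobNorm_mul_le _ _) (specNorm_nonneg _)

lemma lambdaMin_mul_le {M : Matrix ι ι ℝ} (hM : M.IsHermitian) (v : ι → ℝ) :
    lambdaMin M * (v ⬝ᵥ v) ≤ v ⬝ᵥ (M *ᵥ v) := by
  have h : (M - algebraMap ℝ _ (lambdaMin M)).PosSemidef := by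
    rw [Matrix.posSemidef_iff_isHermitian_and_spectrum_nonneg]
    refine ⟨hM.sub ?_, ?_⟩
    · rw [Matrix.algebraMap_eq_diagonal]
      exact Matrix.isHermitian_diagonal _
    · intro x hx
      rw [← spectrum.sub_singleton_eq] at hx
      obtain ⟨y, hy, z, rfl, rfl⟩ := hx
      exact sub_nonneg.2 (csInf_le M.finite_real_spectrum.bddBelow hy)
  have := h.dotProduct_mulVec_nonneg v
  simp [Matrix.sub_mulVec, Algebra.algebraMap_eq_smul_one, Matrix.smul_mulVec] at this
  exact this

lemma le_lambdaMax_mul {M : Matrix ι ι ℝ} (hM : M.IsHermitian) (v : ι → ℝ) :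
    v ⬝ᵥ (M *ᵥ v) ≤ lambdaMax M * (v ⬝ᵥ v) := by
  have h : (algebraMap ℝ _ (lambdaMax M) - M).PosSemidef := by
    rw [Matrix.posSemidef_iff_isHermitian_and_spectrum_nonneg]
    refine ⟨Matrix.IsHermitian.sub ?_ hM, ?_⟩
    · rw [Matrix.algebraMap_eq_diagonal]
      exact Matrix.isHermitian_diagonal _
    · intro x hx
      rw [← spectrum.singleton_sub_eq] at hx
      obtain ⟨z, rfl, y, hy, rfl⟩ := hx
      exact sub_nonneg.2 (le_csSup M.finite_real_spectrum.bddAbove hy)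
  have := h.dotProduct_mulVec_nonneg v
  simp [Matrix.sub_mulVec, Algebra.algebraMap_eq_smul_one, Matrix.smul_mulVec] at this
  exact this

lemma lambdaMin_pos [Nonempty ι] {M : Matrix ι ι ℝ} (hM : M.PosDef) : 0 < lambdaMin M := by
  have hne : (spectrum ℝ M).Nonempty := by
    rw [hM.isHermitian.spectrum_real_eq_range_eigenvalues]
    exact Set.range_nonempty _
  have h := hne.csInf_mem M.finite_real_spectrum
  rw [hM.isHermitian.spectrum_real_eq_range_eigenvalues] at h
  obtain ⟨i, hi⟩ := h
  rw [lambdaMin, hM.isHermitian.spectrum_real_eq_range_eigenvalues, ← hi]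
  exact hM.eigenvalues_pos i

/-- For invertible `M` the matrices `M * Mᵀ` and `Mᵀ * M` are similar, so the bound from `Mᵀ * M`
can be stated with `M * Mᵀ`. -/
lemma dotProduct_mulVec_self_le_lambdaMax {M : Matrix ι ι ℝ} (hM : IsUnit M) (v : ι → ℝ) :
    (M *ᵥ v) ⬝ᵥ (M *ᵥ v) ≤ lambdaMax (M * Mᵀ) * (v ⬝ᵥ v) := by
  have h : lambdaMax (M * Mᵀ) = lambdaMax (Mᵀ * M) := by
    obtain ⟨u, rfl⟩ := hM
    unfold lambdaMax
    rw [← spectrum.units_conjugate (u := u) (a := (u : Matrix ι ι ℝ)ᵀ * u)]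
    simp [mul_assoc]
  have hH : (Mᵀ * M).IsHermitian := by
    simpa using Matrix.isHermitian_conjTranspose_mul_self M
  rw [h]
  refine le_trans (le_of_eq ?_) (le_lambdaMax_mul hH v)
  rw [← Matrix.mulVec_mulVec, dotProduct_transpose_mulVec]

lemma lambdaMin_neg_symmPart_mul_le (M : Matrix ι ι ℝ) (v : ι → ℝ) :
    lambdaMin (-((1 / 2 : ℝ) • (M + Mᵀ))) * (v ⬝ᵥ v) ≤ -(v ⬝ᵥ (M *ᵥ v)) := by
  have hH : (-((1 / 2 : ℝ) • (M + Mᵀ))).IsHermitian := by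
    rw [Matrix.IsHermitian, Matrix.conjTranspose_eq_transpose_of_trivial]
    simp [add_comm]
  refine (lambdaMin_mul_le hH v).trans (le_of_eq ?_)
  simp only [Matrix.neg_mulVec, Matrix.smul_mulVec, Matrix.add_mulVec, dotProduct_neg,
    dotProduct_smul, dotProduct_add, dotProduct_transpose_mulVec, smul_eq_mul]
  rw [dotProduct_comm (M *ᵥ v) v]
  ring

lemma NegDefPart.isUnit {M : Matrix ι ι ℝ} (h : NegDefPart M) : IsUnit M := by
  rw [← Matrix.mulVec_injective_iff_isUnit, ← Matrix.coe_mulVecLin, injective_iff_map_eq_zero]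
  intro v hv
  by_contra hne
  have := h v hne
  rw [Matrix.mulVecLin_apply] at hv
  simp [hv] at this

lemma NegDefPart.lambdaMax_pos [Nonempty ι] {M : Matrix ι ι ℝ} (h : NegDefPart M) :
    0 < lambdaMax (M * Mᵀ) := by
  obtain ⟨v, hv⟩ := exists_ne (0 : ι → ℝ)
  have h1 := dotProduct_mulVec_self_le_lambdaMax h.isUnit v
  have h2 : M *ᵥ v ≠ 0 := fun h0 => by simpa [h0] using h v hv
  exact pos_of_mul_pos_left ((dotProduct_self_pos h2).trans_le h1) (dotProduct_self_nonneg' v)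

/-! ### Elman's contraction estimate -/

/-- The squared contraction factor `1 - λ_min(-(M + Mᵀ)/2)² / λ_max(M Mᵀ)`. -/
def elmanFactor (M : Matrix ι ι ℝ) : ℝ :=
  1 - lambdaMin (-((1 / 2 : ℝ) • (M + Mᵀ))) ^ 2 / lambdaMax (M * Mᵀ)

/-- The Richardson step length for which the factor `elmanFactor M` is attained. -/
def elmanStep (M : Matrix ι ι ℝ) : ℝ :=
  lambdaMin (-((1 / 2 : ℝ) • (M + Mᵀ))) / lambdaMax (M * Mᵀ)

/-- With `a`, `b` the two extreme eigenvalues, expanding the square bounds it by `1 - 2 c a + c² b`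
times `w ⬝ᵥ w`; the step `c = a / b` minimizes this, with value `1 - a² / b`. -/
lemma NegDefPart.elman_step [Nonempty ι] {M : Matrix ι ι ℝ} (h : NegDefPart M) (w : ι → ℝ) :
    ((1 + elmanStep M • M) *ᵥ w) ⬝ᵥ ((1 + elmanStep M • M) *ᵥ w) ≤
      elmanFactor M * (w ⬝ᵥ w) := by
  have hb := h.lambdaMax_pos
  have ha := lambdaMin_pos h.posDef
  have h1 := lambdaMin_neg_symmPart_mul_le M w
  have h2 := dotProduct_mulVec_self_le_lambdaMax h.isUnit w
  unfold elmanStep elmanFactor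
  set a := lambdaMin (-((1 / 2 : ℝ) • (M + Mᵀ)))
  set b := lambdaMax (M * Mᵀ)
  simp only [Matrix.add_mulVec, Matrix.one_mulVec, Matrix.smul_mulVec, dotProduct_add,
    add_dotProduct, dotProduct_smul, smul_dotProduct, smul_eq_mul]
  rw [dotProduct_comm (M *ᵥ w) w]
  have hc : 0 < a / b := by positivity
  have h3 := mul_le_mul_of_nonneg_left h1 hc.le
  have h4 := mul_le_mul_of_nonneg_left h2 (mul_pos hc hc).le
  have h5 : a / b * (a / b) * (b * (w ⬝ᵥ w)) = a ^ 2 / b * (w ⬝ᵥ w) := by field_simp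
  have h6 : a / b * (a * (w ⬝ᵥ w)) = a ^ 2 / b * (w ⬝ᵥ w) := by ring
  rw [h5] at h4
  rw [h6] at h3
  linarith

lemma NegDefPart.elmanFactor_nonneg [Nonempty ι] {M : Matrix ι ι ℝ} (h : NegDefPart M) :
    0 ≤ elmanFactor M := by
  obtain ⟨v, hv⟩ := exists_ne (0 : ι → ℝ)
  exact nonneg_of_mul_nonneg_left ((dotProduct_self_nonneg' _).trans (h.elman_step v))
    (dotProduct_self_pos hv)

lemma NegDefPart.elmanFactor_lt_one [Nonempty ι] {M : Matrix ι ι ℝ} (h : NegDefPart M) :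
    elmanFactor M < 1 := by
  have hb := h.lambdaMax_pos
  have ha := lambdaMin_pos h.posDef
  unfold elmanFactor
  have : 0 < lambdaMin (-((1 / 2 : ℝ) • (M + Mᵀ))) ^ 2 / lambdaMax (M * Mᵀ) := by positivity
  linarith

lemma NegDefPart.elman_pow [Nonempty ι] {M : Matrix ι ι ℝ} (h : NegDefPart M) (w : ι → ℝ)
    (m : ℕ) :
    (((1 + elmanStep M • M) ^ m) *ᵥ w) ⬝ᵥ (((1 + elmanStep M • M) ^ m) *ᵥ w) ≤
      elmanFactor M ^ m * (w ⬝ᵥ w) := by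
  induction m with
  | zero => simp
  | succ m ih =>
    rw [pow_succ', ← Matrix.mulVec_mulVec, pow_succ', mul_assoc]
    exact (h.elman_step _).trans (mul_le_mul_of_nonneg_left ih h.elmanFactor_nonneg)

/-! ### Krylov spaces and GMRES -/

lemma krylov_mono (M : Matrix ι ι ℝ) (b : ι → ℝ) {m m' : ℕ} (h : m ≤ m') :
    krylov M b m ≤ krylov M b m' :=
  Submodule.span_mono (Set.image_mono fun _ hj => lt_of_lt_of_le hj h)

lemma mulVec_mem_krylov_succ {M : Matrix ι ι ℝ} {b y : ι → ℝ} {m : ℕ} (hy : y ∈ krylov M b m) :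
    M *ᵥ y ∈ krylov M b (m + 1) := by
  have : krylov M b m ≤ (krylov M b (m + 1)).comap M.mulVecLin := by
    refine Submodule.span_le.2 ?_
    rintro _ ⟨j, hj, rfl⟩
    refine Submodule.subset_span ⟨j + 1, Nat.succ_lt_succ hj, ?_⟩
    simp [pow_succ', Matrix.mulVec_mulVec]
  exact this hy

/-- Richardson iteration `y ↦ y - c (b - M y)` from zero stays in the Krylov spaces and multiplies
the residual by `1 + c M`. It supplies the competitor against which GMRES is measured. -/
lemma exists_mem_krylov_residual (M : Matrix ι ι ℝ) (b : ι → ℝ) (c : ℝ) (m : ℕ) :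
    ∃ y ∈ krylov M b m, b - M *ᵥ y = ((1 + c • M) ^ m) *ᵥ b := by
  induction m with
  | zero => exact ⟨0, Submodule.zero_mem _, by simp⟩
  | succ m ih =>
    obtain ⟨y, hy, h⟩ := ih
    have hb : b ∈ krylov M b (m + 1) := Submodule.subset_span ⟨0, Nat.succ_pos m, by simp⟩
    refine ⟨y - c • b + c • (M *ᵥ y),
      add_mem (sub_mem (krylov_mono M b m.le_succ hy) (Submodule.smul_mem _ _ hb))
        (Submodule.smul_mem _ _ (mulVec_mem_krylov_succ hy)), ?_⟩
    rw [pow_succ', ← Matrix.mulVec_mulVec, ← h]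
    simp only [Matrix.add_mulVec, Matrix.one_mulVec, Matrix.smul_mulVec, Matrix.mulVec_add,
      Matrix.mulVec_sub, Matrix.mulVec_smul]
    abel

/-- The orthogonal projection of `b` onto the image of the Krylov space under `M` attains the
minimum. -/
lemma exists_isGMRESIterate (M : Matrix ι ι ℝ) (b : ι → ℝ) (m : ℕ) :
    ∃ x, IsGMRESIterate M b m x := by
  let f : (ι → ℝ) →ₗ[ℝ] EuclideanSpace ℝ ι :=
    (WithLp.linearEquiv 2 ℝ (ι → ℝ)).symm.toLinearMap ∘ₗ M.mulVecLin
  let W := (krylov M b m).map f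
  obtain ⟨x, hx, hxW⟩ : W.starProjection (WithLp.toLp 2 b) ∈ W :=
    Submodule.starProjection_apply_mem _ _
  refine ⟨x, hx, fun y hy => ?_⟩
  have h1 := Submodule.starProjection_minimal (U := W) (WithLp.toLp 2 b : EuclideanSpace ℝ ι)
  rw [← hxW] at h1
  have h2 : (⨅ x : W, ‖(WithLp.toLp 2 b : EuclideanSpace ℝ ι) - x‖) ≤
      ‖(WithLp.toLp 2 b : EuclideanSpace ℝ ι) - f y‖ :=
    ciInf_le (f := fun x : W => ‖(WithLp.toLp 2 b : EuclideanSpace ℝ ι) - x‖)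
      ⟨0, by rintro _ ⟨_, rfl⟩; exact norm_nonneg _⟩ ⟨f y, Submodule.mem_map_of_mem hy⟩
  exact h1.le.trans h2

/-- Comparison with the midpoint and the parallelogram law force the two residuals to agree;
injectivity of `M` does the rest. -/
lemma IsGMRESIterate.unique {M : Matrix ι ι ℝ} (hM : IsUnit M) {b : ι → ℝ} {m : ℕ}
    {x z : ι → ℝ} (hx : IsGMRESIterate M b m x) (hz : IsGMRESIterate M b m z) : x = z := by
  have hmem : (1 / 2 : ℝ) • (x + z) ∈ krylov M b m :=
    Submodule.smul_mem _ _ (add_mem hx.mem hz.mem)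
  have h1 := (norm_toLp_le_iff _ _).1 (hx.min _ hmem)
  have h2 := (norm_toLp_le_iff _ _).1 (hz.min _ hmem)
  have h3 : b - M *ᵥ ((1 / 2 : ℝ) • (x + z)) =
      (1 / 2 : ℝ) • ((b - M *ᵥ x) + (b - M *ᵥ z)) := by
    rw [Matrix.mulVec_smul, Matrix.mulVec_add]
    module
  rw [h3] at h1 h2
  have h4 : (b - M *ᵥ x) - (b - M *ᵥ z) = 0 := by
    refine dotProduct_self_eq_zero.1 (le_antisymm ?_ (dotProduct_self_nonneg' _))
    generalize b - M *ᵥ x = r at *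
    generalize b - M *ᵥ z = s at *
    simp only [smul_dotProduct, dotProduct_smul, dotProduct_add, add_dotProduct,
      sub_dotProduct, dotProduct_sub, smul_eq_mul] at *
    rw [dotProduct_comm s r] at *
    linarith
  refine Matrix.mulVec_injective_iff_isUnit.2 hM ?_
  simpa [sub_eq_zero, eq_comm] using h4

end Generic

/-! ### Lyapunov equations and the scaling by `L` -/

section Lyapunov

variable {ι : Type*} [Fintype ι] [DecidableEq ι]

lemma lyapMatrix_mulVec_vec (C Y : Matrix ι ι ℝ) :
    lyapMatrix C *ᵥ Y.vec = (Cᵀ * Y + Y * C).vec := by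
  simp [lyapMatrix, Matrix.add_mulVec, Matrix.kronecker_mulVec_vec]

/-- Every iterate of GMRES for a Lyapunov equation with symmetric right-hand side is symmetric. -/
lemma isSymm_of_vec_mem_krylov_lyapMatrix {C B Y : Matrix ι ι ℝ} (hB : B.IsSymm) {m : ℕ}
    (hY : Y.vec ∈ krylov (lyapMatrix C) B.vec m) : Y.IsSymm := by
  -- Vectors fixed by swapping the index pair are the vectorized symmetric matrices; the Lyapunov
  -- operator preserves them.
  let V : Submodule ℝ (ι × ι → ℝ) :=
    LinearMap.eqLocus (LinearMap.funLeft ℝ ℝ Prod.swap) LinearMap.id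
  have hV : ∀ Z : Matrix ι ι ℝ, Z.vec ∈ V ↔ Z.IsSymm := fun Z => by
    change Z.vec ∘ Prod.swap = Z.vec ↔ _
    rw [← Matrix.vec_transpose, Matrix.vec_inj, Matrix.IsSymm]
  rw [← hV]
  refine (Submodule.span_le.2 ?_ : krylov (lyapMatrix C) B.vec m ≤ V) hY
  rintro _ ⟨j, -, rfl⟩
  change (lyapMatrix C ^ j) *ᵥ B.vec ∈ V
  clear hY
  induction j with
  | zero => simpa using (hV B).2 hB
  | succ j ih =>
    obtain ⟨Z, hZ⟩ := Matrix.vec_bijective.surjective ((lyapMatrix C ^ j) *ᵥ B.vec)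
    rw [← hZ, hV] at ih
    rw [pow_succ', ← Matrix.mulVec_mulVec, ← hZ, lyapMatrix_mulVec_vec, hV, Matrix.IsSymm]
    simp [ih.eq, add_comm]

/-- Congruence by `L` turns `C` into the similar matrix `L⁻¹ C L`. -/
lemma scaledLyapMatrix_eq {L : Matrix ι ι ℝ} (hL : IsUnit L) (C : Matrix ι ι ℝ) :
    scaledLyapMatrix L C = lyapMatrix (L⁻¹ * C * L) := by
  have hLd : IsUnit L.det := (Matrix.isUnit_iff_isUnit_det L).1 hL
  have h1 : Lᵀ * (L⁻¹)ᵀ = 1 := by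
    rw [← Matrix.transpose_mul, Matrix.nonsing_inv_mul _ hLd, Matrix.transpose_one]
  simp only [scaledLyapMatrix, lyapMatrix, mul_add, add_mul, ← Matrix.mul_kronecker_mul, mul_one,
    h1, Matrix.transpose_mul, mul_assoc]

lemma kronecker_mul_lyapMatrix {L : Matrix ι ι ℝ} (hL : IsUnit L) (C : Matrix ι ι ℝ) :
    (Lᵀ ⊗ₖ Lᵀ) * lyapMatrix C = scaledLyapMatrix L C * (Lᵀ ⊗ₖ Lᵀ) := by
  have hLd : IsUnit L.det := (Matrix.isUnit_iff_isUnit_det L).1 hL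
  rw [scaledLyapMatrix, mul_assoc _ _ (Lᵀ ⊗ₖ Lᵀ), ← Matrix.mul_kronecker_mul,
    ← Matrix.transpose_mul, Matrix.mul_nonsing_inv _ hLd]
  simp

/-- The symmetric part of a Kronecker sum is the Kronecker sum of the symmetric parts, and Kronecker
products of positive definite matrices are positive definite. -/
lemma NegDefPart.lyapMatrix {K : Matrix ι ι ℝ} (hK : NegDefPart K) :
    NegDefPart (lyapMatrix K) := by
  have h1 := hK.posDef
  have h2 : ((1 : Matrix ι ι ℝ) ⊗ₖ (-((1 / 2 : ℝ) • (K + Kᵀ))) +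
      (-((1 / 2 : ℝ) • (K + Kᵀ))) ⊗ₖ (1 : Matrix ι ι ℝ)).PosDef :=
    (Matrix.PosDef.one.kronecker h1).add (h1.kronecker Matrix.PosDef.one)
  have h3 : (1 : Matrix ι ι ℝ) ⊗ₖ (-((1 / 2 : ℝ) • (K + Kᵀ))) +
      (-((1 / 2 : ℝ) • (K + Kᵀ))) ⊗ₖ (1 : Matrix ι ι ℝ) =
      -((1 / 2 : ℝ) • (Tink.lyapMatrix K + (Tink.lyapMatrix K)ᵀ)) := by
    ext ⟨i, j⟩ ⟨k, l⟩
    simp [Tink.lyapMatrix, Matrix.one_apply, eq_comm]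
    split_ifs <;> ring
  rw [h3] at h2
  intro v hv
  have := h2.dotProduct_mulVec_pos hv
  simp only [Matrix.neg_mulVec, Matrix.smul_mulVec, Matrix.add_mulVec, dotProduct_neg, star_trivial,
    dotProduct_smul, dotProduct_add, dotProduct_transpose_mulVec, smul_eq_mul] at this
  rw [dotProduct_comm (Tink.lyapMatrix K *ᵥ v) v] at this
  linarith

lemma isUnit_lyapMatrix {L C : Matrix ι ι ℝ} (hL : IsUnit L) (hK : NegDefPart (L⁻¹ * C * L)) :
    IsUnit (lyapMatrix C) := by
  have h1 : IsUnit (scaledLyapMatrix L C) := by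
    rw [scaledLyapMatrix_eq hL]
    exact hK.lyapMatrix.isUnit
  rw [Matrix.isUnit_iff_isUnit_det] at h1 ⊢
  rw [scaledLyapMatrix, Matrix.det_mul, Matrix.det_mul] at h1
  exact (IsUnit.mul_iff.1 (IsUnit.mul_iff.1 h1).1).2

lemma existsUnique_isInnerSolve {A F Q X : Matrix ι ι ℝ}
    (h : IsUnit (lyapMatrix (closedLoop A F X))) (m : ℕ) :
    ∃! Y : Matrix ι ι ℝ, IsInnerSolve A F Q X m Y := by
  obtain ⟨x, hx⟩ := exists_isGMRESIterate (lyapMatrix (closedLoop A F X)) (-(X * F * X + Q).vec) m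
  obtain ⟨Y, rfl⟩ := Matrix.vec_bijective.surjective x
  exact ⟨Y, hx, fun Z hZ => Matrix.vec_inj.1 (IsGMRESIterate.unique h hZ hx)⟩

/-- Elman's bound for the GMRES residual of a Lyapunov equation, transported through the scaling
by `Lᵀ ⊗ Lᵀ`. -/
lemma frobNorm_residual_le [Nonempty ι] {L F C B Y : Matrix ι ι ℝ} (hL : IsUnit L)
    (hLF : L * Lᵀ = F) (hK : NegDefPart (L⁻¹ * C * L)) {m : ℕ}
    (hY : IsGMRESIterate (lyapMatrix C) B.vec m Y.vec) :
    frobNorm (B - (Cᵀ * Y + Y * C)) ^ 2 ≤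
      elmanFactor (scaledLyapMatrix L C) ^ m * (cond2 F * frobNorm B) ^ 2 := by
  have hLd : IsUnit L.det := (Matrix.isUnit_iff_isUnit_det L).1 hL
  have hS : NegDefPart (scaledLyapMatrix L C) := by
    rw [scaledLyapMatrix_eq hL]
    exact hK.lyapMatrix
  obtain ⟨y, hy, hres⟩ := exists_mem_krylov_residual (lyapMatrix C) B.vec
    (elmanStep (scaledLyapMatrix L C)) m
  have h1 := (norm_toLp_le_iff _ _).1 (hY.min y hy)
  rw [hres, lyapMatrix_mulVec_vec, ← Matrix.vec_sub, ← frobNorm_sq] at h1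
  set c := elmanStep (scaledLyapMatrix L C)
  obtain ⟨R, hR⟩ := Matrix.vec_bijective.surjective (((1 + c • lyapMatrix C) ^ m) *ᵥ B.vec)
  rw [← hR, ← frobNorm_sq] at h1
  -- The competitor is a polynomial in the unscaled matrix, where GMRES runs, but its step length is
  -- that of the scaled one; intertwining transfers the contraction.
  have hcomm : (Lᵀ ⊗ₖ Lᵀ) * (1 + c • lyapMatrix C) ^ m =
      (1 + c • scaledLyapMatrix L C) ^ m * (Lᵀ ⊗ₖ Lᵀ) := by
    refine (SemiconjBy.pow_right (?_ : SemiconjBy (Lᵀ ⊗ₖ Lᵀ) _ _) m).eq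
    rw [SemiconjBy, mul_add, add_mul, mul_smul_comm, smul_mul_assoc, kronecker_mul_lyapMatrix hL]
    simp
  have hT : ∀ Z : Matrix ι ι ℝ, (Lᵀ ⊗ₖ Lᵀ) *ᵥ Z.vec = (Lᵀ * Z * L).vec := fun Z => by
    rw [Matrix.kronecker_mulVec_vec, Matrix.transpose_transpose]
  have h2 : frobNorm (Lᵀ * R * L) ^ 2 ≤
      elmanFactor (scaledLyapMatrix L C) ^ m * frobNorm (Lᵀ * B * L) ^ 2 := by
    rw [frobNorm_sq, frobNorm_sq, ← hT, ← hT, hR, Matrix.mulVec_mulVec, hcomm,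
      ← Matrix.mulVec_mulVec]
    exact hS.elman_pow _ _
  have h3 : frobNorm (Lᵀ * B * L) ≤ specNorm F * frobNorm B := by
    have := frobNorm_mul_mul_transpose_le Lᵀ B
    rwa [Matrix.transpose_transpose, specNorm_transpose, ← specNorm_mul_transpose, hLF] at this
  have h4 : frobNorm R ≤ specNorm F⁻¹ * frobNorm (Lᵀ * R * L) := by
    have := frobNorm_mul_mul_transpose_le (L⁻¹)ᵀ (Lᵀ * R * L)
    have e1 : (L⁻¹)ᵀ * (Lᵀ * R * L) * ((L⁻¹)ᵀ)ᵀ = R := by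
      have e2 : (L⁻¹)ᵀ * Lᵀ = 1 := by
        rw [← Matrix.transpose_mul, Matrix.mul_nonsing_inv _ hLd, Matrix.transpose_one]
      rw [Matrix.transpose_transpose, Matrix.mul_assoc Lᵀ, ← Matrix.mul_assoc _ Lᵀ, e2, one_mul,
        mul_assoc, Matrix.mul_nonsing_inv _ hLd, mul_one]
    rwa [e1, ← specNorm_mul_transpose, Matrix.transpose_transpose, Matrix.transpose_nonsing_inv,
      ← Matrix.mul_inv_rev, hLF] at this
  have hρ := pow_nonneg hS.elmanFactor_nonneg m
  calc _ ≤ frobNorm R ^ 2 := h1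
    _ ≤ (specNorm F⁻¹ * frobNorm (Lᵀ * R * L)) ^ 2 :=
        pow_le_pow_left₀ (frobNorm_nonneg _) h4 2
    _ = specNorm F⁻¹ ^ 2 * frobNorm (Lᵀ * R * L) ^ 2 := mul_pow _ _ _
    _ ≤ specNorm F⁻¹ ^ 2 * (elmanFactor (scaledLyapMatrix L C) ^ m *
          (specNorm F * frobNorm B) ^ 2) := by
        refine mul_le_mul_of_nonneg_left (h2.trans (mul_le_mul_of_nonneg_left ?_ hρ))
          (sq_nonneg _)
        exact pow_le_pow_left₀ (frobNorm_nonneg _) h3 2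
    _ = _ := by rw [cond2]; ring

/-- The solution of a Lyapunov equation with negative definite right-hand side is positive
semidefinite if `L⁻¹ C L` has negative definite symmetric part. -/
lemma posSemidef_of_lyapunov {L C Y : Matrix ι ι ℝ} (hL : IsUnit L)
    (hK : NegDefPart (L⁻¹ * C * L)) (hY : Y.IsSymm)
    (h : NegDefPart (Cᵀ * Y + Y * C)) : Y.PosSemidef := by
  have hLd : IsUnit L.det := (Matrix.isUnit_iff_isUnit_det L).1 hL
  have hZH : (Lᵀ * Y * L).IsHermitian := by
    rw [Matrix.IsHermitian, Matrix.conjTranspose_eq_transpose_of_trivial]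
    simp [hY.eq, mul_assoc]
  have hZ : (Lᵀ * Y * L).PosSemidef := by
    rw [hZH.posSemidef_iff_eigenvalues_nonneg]
    intro i
    set v : ι → ℝ := WithLp.ofLp (hZH.eigenvectorBasis i)
    have hv : v ≠ 0 := by
      intro h0
      refine hZH.eigenvectorBasis.orthonormal.ne_zero i ?_
      ext j
      exact congrFun h0 j
    have hev : (Lᵀ * Y * L) *ᵥ v = hZH.eigenvalues i • v := hZH.mulVec_eigenvectorBasis i
    have hLv : L *ᵥ v ≠ 0 := fun h0 => hv <|
      Matrix.mulVec_injective_iff_isUnit.2 hL (by simpa using h0)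
    have h1 := h _ hLv
    have h2 := hK v hv
    -- Testing on an eigenvector `v` of `Lᵀ Y L` turns the equation into a scalar one: both
    -- quadratic forms are negative, so the eigenvalue cannot be.
    have e1 : (L *ᵥ v) ⬝ᵥ ((Cᵀ * Y + Y * C) *ᵥ (L *ᵥ v)) =
        2 * hZH.eigenvalues i * (v ⬝ᵥ ((L⁻¹ * C * L) *ᵥ v)) := by
      have e2 : Lᵀ * (Cᵀ * Y + Y * C) * L =
          (L⁻¹ * C * L)ᵀ * (Lᵀ * Y * L) + (Lᵀ * Y * L) * (L⁻¹ * C * L) := by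
        have e3 : L * (L⁻¹ * (C * L)) = C * L := by
          rw [← mul_assoc, Matrix.mul_nonsing_inv _ hLd, one_mul]
        have e4 : (L⁻¹ᵀ) * (Lᵀ * (Y * L)) = Y * L := by
          rw [← mul_assoc, ← Matrix.transpose_mul, Matrix.mul_nonsing_inv _ hLd,
            Matrix.transpose_one, one_mul]
        simp only [Matrix.transpose_mul, mul_assoc, mul_add, add_mul, e3, e4]
      rw [← dotProduct_transpose_mulVec, Matrix.mulVec_mulVec, Matrix.mulVec_mulVec,
        e2, Matrix.add_mulVec, dotProduct_add, ← Matrix.mulVec_mulVec, hev,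
        dotProduct_transpose_mulVec, ← Matrix.mulVec_mulVec v (Lᵀ * Y * L)]
      have e5 : v ⬝ᵥ (Lᵀ * Y * L) *ᵥ ((L⁻¹ * C * L) *ᵥ v) =
          (hZH.eigenvalues i • v) ⬝ᵥ ((L⁻¹ * C * L) *ᵥ v) := by
        rw [← hev, ← dotProduct_transpose_mulVec,
          ← Matrix.conjTranspose_eq_transpose_of_trivial (Lᵀ * Y * L), hZH.eq]
      rw [e5, dotProduct_smul, smul_dotProduct, dotProduct_comm _ v, smul_eq_mul]
      ring
    rw [e1] at h1
    by_contra hneg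
    nlinarith [mul_pos_of_neg_of_neg (not_le.1 hneg) h2]
  rwa [← Matrix.conjTranspose_eq_transpose_of_trivial, ← Matrix.star_eq_conjTranspose,
    Matrix.IsUnit.posSemidef_star_left_conjugate_iff hL] at hZ

end Lyapunov

/-! ### Numerical range, stability and the inexact Newton step -/

section Riccati

variable {ι : Type*} [Fintype ι]

lemma negDefPart_of_numericalRange {M : Matrix ι ι ℝ}
    (h : numericalRange (M.map (algebraMap ℝ ℂ)) ⊆ {z : ℂ | z.re < 0}) : NegDefPart M := by
  intro v hv
  have hs := dotProduct_self_pos hv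
  set s := Real.sqrt (v ⬝ᵥ v) with hs_def
  have hs0 : 0 < s := Real.sqrt_pos.2 hs
  have hss : s * s = v ⬝ᵥ v := Real.mul_self_sqrt hs.le
  set u : ι → ℝ := s⁻¹ • v with hu
  have huu : u ⬝ᵥ u = 1 := by
    rw [hu, smul_dotProduct, dotProduct_smul, ← hss]
    simp only [smul_eq_mul]
    field_simp
  have hmem : ((u ⬝ᵥ (M *ᵥ u) : ℝ) : ℂ) ∈ numericalRange (M.map (algebraMap ℝ ℂ)) := by
    refine ⟨WithLp.toLp 2 (fun i => (u i : ℂ)), ?_, ?_⟩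
    · rw [EuclideanSpace.norm_eq, Real.sqrt_eq_one]
      simpa [dotProduct, sq] using huu
    · simp [dotProduct, Matrix.mulVec]
  have hneg : u ⬝ᵥ (M *ᵥ u) < 0 := by simpa using h hmem
  rw [hu, Matrix.mulVec_smul, smul_dotProduct, dotProduct_smul, smul_eq_mul, smul_eq_mul,
    ← mul_assoc] at hneg
  exact neg_of_mul_neg_right hneg (by positivity)

variable [DecidableEq ι]

/-- For an eigenvector `a + i b`, the quadratic forms at `a` and `b` add up to `μ.re` times the
squared norm. -/
lemma NegDefPart.isStable {M : Matrix ι ι ℝ} (h : NegDefPart M) : IsStable M := by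
  intro μ hμ
  rw [← Matrix.spectrum_toLin', ← Module.End.hasEigenvalue_iff_mem_spectrum] at hμ
  obtain ⟨w, hw, hw0⟩ := hμ.exists_hasEigenvector
  rw [Module.End.mem_eigenspace_iff, Matrix.toLin'_apply] at hw
  set a : ι → ℝ := fun i => (w i).re with ha
  set b : ι → ℝ := fun i => (w i).im with hb
  have hre : M *ᵥ a = μ.re • a - μ.im • b := by
    ext i
    simpa [Matrix.mulVec, dotProduct, ha, hb] using congrArg Complex.re (congrFun hw i)
  have him : M *ᵥ b = μ.re • b + μ.im • a := by
    ext i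
    simpa [Matrix.mulVec, dotProduct, ha, hb] using congrArg Complex.im (congrFun hw i)
  have hle : ∀ v : ι → ℝ, v ⬝ᵥ (M *ᵥ v) ≤ 0 := fun v => by
    by_cases hv : v = 0
    · simp [hv]
    · exact (h v hv).le
  have hab : a ≠ 0 ∨ b ≠ 0 := by
    by_contra! hc
    exact hw0 (funext fun i => Complex.ext (congrFun hc.1 i) (congrFun hc.2 i))
  have hsum : a ⬝ᵥ (M *ᵥ a) + b ⬝ᵥ (M *ᵥ b) = μ.re * (a ⬝ᵥ a + b ⬝ᵥ b) := by
    rw [hre, him]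
    simp only [dotProduct_sub, dotProduct_add, dotProduct_smul, smul_eq_mul]
    rw [dotProduct_comm b a]
    ring
  have hlt : a ⬝ᵥ (M *ᵥ a) + b ⬝ᵥ (M *ᵥ b) < 0 := by
    rcases hab with h0 | h0
    · linarith [h a h0, hle b]
    · linarith [h b h0, hle a]
  rw [hsum] at hlt
  exact neg_of_mul_neg_left hlt
    (add_nonneg (dotProduct_self_nonneg' a) (dotProduct_self_nonneg' b))

lemma isStable_of_conj {L C : Matrix ι ι ℝ} (hL : IsUnit L) (h : IsStable (L⁻¹ * C * L)) :
    IsStable C := by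
  intro μ hμ
  refine h μ ?_
  obtain ⟨u, rfl⟩ := hL
  rw [← Matrix.coe_units_inv]
  let U : (Matrix ι ι ℂ)ˣ := Units.map ((algebraMap ℝ ℂ).mapMatrix (m := ι)).toMonoidHom u
  have e : (((u⁻¹ : (Matrix ι ι ℝ)ˣ) : Matrix ι ι ℝ) * C * (u : Matrix ι ι ℝ)).map (algebraMap ℝ ℂ) =
      ((U⁻¹ : (Matrix ι ι ℂ)ˣ) : Matrix ι ι ℂ) * C.map (algebraMap ℝ ℂ) * (U : Matrix ι ι ℂ) := by
    rw [Matrix.map_mul, Matrix.map_mul]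
    rfl
  rwa [e, spectrum.units_conjugate']

lemma negDefPart_conj_closedLoop {A F L X : Matrix ι ι ℝ} (hL : IsUnit L) (hLF : L * Lᵀ = F)
    (hW : NegDefPart (L⁻¹ * A * L)) (hX : X.PosSemidef) :
    NegDefPart (L⁻¹ * closedLoop A F X * L) := by
  have hLd : IsUnit L.det := (Matrix.isUnit_iff_isUnit_det L).1 hL
  have e : L⁻¹ * closedLoop A F X * L = L⁻¹ * A * L - Lᵀ * X * L := by
    rw [closedLoop, ← hLF, mul_sub, sub_mul, mul_assoc L, ← mul_assoc L⁻¹ L,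
      Matrix.nonsing_inv_mul _ hLd, one_mul]
  intro v hv
  have h1 := hW v hv
  have h2 := (hX.conjTranspose_mul_mul_same L).dotProduct_mulVec_nonneg v
  rw [Matrix.conjTranspose_eq_transpose_of_trivial, star_trivial] at h2
  rw [e, Matrix.sub_mulVec, dotProduct_sub]
  linarith

lemma cond2_pos_of_isUnit [Nonempty ι] {M : Matrix ι ι ℝ} (hM : IsUnit M) : 0 < cond2 M := by
  have h : ∀ N : Matrix ι ι ℝ, N ≠ 0 → 0 < specNorm N := fun N hN => by
    rw [specNorm, norm_pos_iff]
    simpa using hN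
  refine mul_pos (h _ hM.ne_zero) (h _ ?_)
  exact ((Matrix.isUnit_nonsing_inv_iff).2 hM).ne_zero

/-- For `ρ = 0` the convention `Real.log 0 = 0` empties the bound, and `m ≠ 0` is what makes `ρ ^ m`
vanish. -/
lemma pow_mul_sq_le_of_log_bound {ρ c : ℝ} {m : ℕ} (hm : m ≠ 0) (hρ0 : 0 ≤ ρ) (hρ1 : ρ < 1)
    (hc : 0 < c) (h : 2 * Real.log c / (-Real.log ρ) ≤ m) : ρ ^ m * c ^ 2 ≤ 1 := by
  rcases hρ0.eq_or_lt with rfl | hρ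
  · simp [hm]
  have hlog : 0 < -Real.log ρ := neg_pos.2 (Real.log_neg hρ hρ1)
  rw [div_le_iff₀ hlog] at h
  have hpos : 0 < ρ ^ m * c ^ 2 := by positivity
  rw [← Real.log_nonpos_iff hpos.le, Real.log_mul (by positivity) (by positivity), Real.log_pow,
    Real.log_pow]
  push_cast
  linarith

lemma IsInnerSolve.posSemidef [Nonempty ι] {A F Q L X Y : Matrix ι ι ℝ} (hL : IsUnit L)
    (hLF : L * Lᵀ = F) (hF : F.PosDef) (hQ : Q.PosDef) (hW : NegDefPart (L⁻¹ * A * L))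
    (hX : X.PosSemidef) {m : ℕ} (hY : IsInnerSolve A F Q X m Y)
    (hm : iterBound A F Q L X ≤ m) : Y.PosSemidef := by
  -- Without inner iterations the Krylov space is zero, so the residual estimate is not needed.
  rcases eq_or_ne m 0 with rfl | hm0
  · have : Y = 0 := by simpa [krylov] using hY.mem
    rw [this]
    exact Matrix.PosSemidef.zero
  have hK := negDefPart_conj_closedLoop hL hLF hW hX
  have hS : NegDefPart (scaledLyapMatrix L (closedLoop A F X)) := by
    rw [scaledLyapMatrix_eq hL]
    exact hK.lyapMatrix
  have hXs : Xᵀ = X := by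
    rw [← Matrix.conjTranspose_eq_transpose_of_trivial]; exact hX.isHermitian
  have hFs : Fᵀ = F := by
    rw [← Matrix.conjTranspose_eq_transpose_of_trivial]; exact hF.isHermitian
  have hQs : Qᵀ = Q := by
    rw [← Matrix.conjTranspose_eq_transpose_of_trivial]; exact hQ.isHermitian
  have hXFX : (X * F * X).PosSemidef := by
    simpa [hXs] using hF.posSemidef.conjTranspose_mul_mul_same X
  rw [IsInnerSolve, ← Matrix.vec_neg] at hY
  have hB : (-(X * F * X + Q)).IsSymm := by
    simp [Matrix.IsSymm, hXs, hFs, hQs, mul_assoc]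
  have hYs := isSymm_of_vec_mem_krylov_lyapMatrix hB hY.mem
  have hq := lambdaMin_pos hQ
  have hres := frobNorm_residual_le hL hLF hK hY
  set C := closedLoop A F X
  have hfrob : frobNorm (-(X * F * X + Q)) = frobNorm (X * F * X + Q) := by
    simp only [frobNorm, Matrix.neg_apply, neg_sq]
  rw [hfrob] at hres
  have hfpos : 0 < frobNorm (X * F * X + Q) := by
    refine (frobNorm_nonneg _).lt_of_ne' fun h0 => ?_
    have h1 := frobNorm_sq (X * F * X + Q)
    rw [h0] at h1
    have h2 : X * F * X + Q = 0 :=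
      Matrix.vec_eq_zero_iff.1 (dotProduct_self_eq_zero.1 (by simpa using h1.symm))
    exact (hQ.posSemidef_add hXFX).isUnit.ne_zero h2
  have hcond : 0 < cond2 F := cond2_pos_of_isUnit hF.isUnit
  have hpow := pow_mul_sq_le_of_log_bound hm0 hS.elmanFactor_nonneg hS.elmanFactor_lt_one
    (by positivity) hm
  set ρ := elmanFactor (scaledLyapMatrix L C) ^ m
  set R := -(X * F * X + Q) - (Cᵀ * Y + Y * C) with hR
  set g := cond2 F * frobNorm (X * F * X + Q)
  have hRle : frobNorm R < lambdaMin Q := by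
    -- Of the constant `1 + √2` only that it exceeds `1` matters: it makes the residual bound
    -- strict.
    have h2 : (1 : ℝ) < (1 + Real.sqrt 2) ^ 2 := by
      nlinarith [Real.sqrt_nonneg 2, Real.sq_sqrt (zero_le_two (α := ℝ)),
        Real.sqrt_pos.2 (zero_lt_two (α := ℝ))]
    have h3 : ρ * g ^ 2 * (1 + Real.sqrt 2) ^ 2 ≤ lambdaMin Q ^ 2 := by
      have e : ρ * ((1 + Real.sqrt 2) * (g / lambdaMin Q)) ^ 2 =
          ρ * g ^ 2 * (1 + Real.sqrt 2) ^ 2 / lambdaMin Q ^ 2 := by field_simp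
      rwa [e, div_le_one (by positivity)] at hpow
    refine lt_of_pow_lt_pow_left₀ 2 hq.le (hres.trans_lt ?_)
    rcases (mul_nonneg (pow_nonneg hS.elmanFactor_nonneg m) (sq_nonneg g)).eq_or_lt with h0 | h0
    · rw [← h0]; positivity
    · exact (lt_mul_of_one_lt_right h0 h2).trans_le h3
  refine posSemidef_of_lyapunov hL hK hYs fun v hv => ?_
  have e : Cᵀ * Y + Y * C = -(X * F * X) - Q - R := by rw [hR]; abel
  have h1 := hXFX.dotProduct_mulVec_nonneg v
  have h2 := lambdaMin_mul_le hQ.isHermitian v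
  have h3 := dotProduct_mulVec_le_frobNorm (-R) v
  have h4 : frobNorm (-R) = frobNorm R := by
    simp only [frobNorm, Matrix.neg_apply, neg_sq]
  rw [star_trivial] at h1
  rw [h4, Matrix.neg_mulVec, dotProduct_neg] at h3
  rw [e, Matrix.sub_mulVec, Matrix.sub_mulVec, dotProduct_sub, dotProduct_sub, Matrix.neg_mulVec,
    dotProduct_neg]
  nlinarith [mul_lt_mul_of_pos_right hRle (dotProduct_self_pos hv)]

end Riccati

end Tink

end

theorem theorem3p1 (n : ℕ) (hn : 0 < n)
    (A F Q L X₀ : Matrix (Fin n) (Fin n) ℝ)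
    (hF : F.PosDef) (hL : Tink.IsCholeskyFactor L F)
    (hW : Tink.numericalRange ((L⁻¹ * A * L).map (algebraMap ℝ ℂ)) ⊆ {z : ℂ | z.re < 0})
    (hX₀ : X₀.PosSemidef) (hX₀_stable : Tink.IsStable (Tink.closedLoop A F X₀))
    (hQ : Q.PosDef)
    (lineSearch : Bool) (α : ℝ) (hα : 0 < α)
    (N : ℕ) (it : ℕ → ℕ) (X Xhat : ℕ → Matrix (Fin n) (Fin n) ℝ) (lam : ℕ → ℝ)
    (hrun : Tink.IsRun A F Q X₀ lineSearch α N it X Xhat lam)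
    (hit : ∀ k < N, Tink.iterBound A F Q L (X k) ≤ (it k : ℝ)) :
    ∀ k ≤ N,
      -- the next inner problem is nonsingular and its GMRES iterates exist and are unique
      (IsUnit (Tink.lyapMatrix (Tink.closedLoop A F (X k))) ∧
        ∀ m : ℕ, ∃! Y : Matrix (Fin n) (Fin n) ℝ, Tink.IsInnerSolve A F Q (X k) m Y) ∧
      (X k).IsSymm ∧ (X k).PosSemidef ∧
      Tink.IsStable (Tink.closedLoop A F (X k)) := by
  have : Nonempty (Fin n) := ⟨⟨0, hn⟩⟩
  have hLF := hL.mul_transpose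
  have hLu : IsUnit L := by
    have h := hF.isUnit
    rw [Matrix.isUnit_iff_isUnit_det] at h ⊢
    rw [← hLF, Matrix.det_mul] at h
    exact (IsUnit.mul_iff.1 h).1
  have hneg := Tink.negDefPart_of_numericalRange hW
  have hpsd : ∀ k ≤ N, (X k).PosSemidef := by
    intro k
    induction k with
    | zero => intro _; rwa [hrun.start]
    | succ k ih =>
      intro hk
      have hX := ih (k.le_succ.trans hk)
      have hXh := (hrun.inner k hk).posSemidef hLu hLF hF hQ hneg hX (hit k hk)
      -- The line search enters only through the range of the step length, not through the residual
      -- decrease.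
      have hlam : 0 ≤ lam k ∧ lam k ≤ 1 := by
        cases hls : lineSearch with
        | false => simp [hrun.step_full hls k hk]
        | true =>
          obtain ⟨h0, h1, -⟩ := hrun.step_search hls k hk
          exact ⟨h0.le, h1.le⟩
      rw [hrun.update k hk]
      exact (hX.smul (sub_nonneg.2 hlam.2)).add (hXh.smul hlam.1)
  intro k hk
  have hX := hpsd k hk
  have hK := Tink.negDefPart_conj_closedLoop hLu hLF hneg hX
  have hU := Tink.isUnit_lyapMatrix hLu hK
  refine ⟨⟨hU, Tink.existsUnique_isInnerSolve hU⟩, ?_, hX, Tink.isStable_of_conj hLu hK.isStable⟩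
  rw [Matrix.IsSymm, ← Matrix.conjTranspose_eq_transpose_of_trivial]
  exact hX.isHermitian
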